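/- Let $R$ be a commutative ring with identity and $S\subseteq R$ a multiplicative subset containing $1$ (possibly containing zero-divisors), and let $R_S$ be the localization of $R$ at $S$. A short exact sequence of $R$-modules is \emph{pure exact} if it remains exact after tensoring with any $R$-module; it is \emph{$S$-pure exact} if it is pure exact, its image under $-\otimes_R R_S$ is a split exact sequence of $R_S$-modules, and for every $s\in S$ its image under $-\otimes_R R/sR$ is a split exact sequence of $R/sR$-modules. A morphism $\varphi\colon U\to Z$ of $R$-modules is a \emph{phantom morphism} (respectively an \emph{$S$-phantom morphism}) if the pullback along $\varphi$ of every short exact sequence $0\to X\to Y\to Z\to 0$ of $R$-modules is pure exact (respectively $S$-pure exact). A commutative ring is \emph{perfect} if every flat module over it is projective. If every phantom morphism of $R$-modules is $S$-phantom, then $R$ is $S$-almost perfect; that is, $R_S$ is a perfect ring and, for every $s\in S$, the quotient ring $R/sR$ is a perfect ring. -/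

import Mathlib

open scoped TensorProduct

universe u

namespace StrongPurity

section Exactness

variable {A : Type u} [CommRing A]
variable {N M L : Type u} [AddCommGroup N] [Module A N] [AddCommGroup M] [Module A M]
  [AddCommGroup L] [Module A L]

/-- `0 → N → M → L → 0` (with maps `f`, `g`) is a short exact sequence of `A`-modules. -/
structure IsShortExact (f : N →ₗ[A] M) (g : M →ₗ[A] L) : Prop where
  injective : Function.Injective f
  exact : Function.Exact f g
  surjective : Function.Surjective g

/-- The short exact sequence `0 → N → M → L → 0` splits, as a sequence of `A`-modules. -/
structure IsSplitExact (f : N →ₗ[A] M) (g : M →ₗ[A] L) : Prop extends IsShortExact f g where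
  split : ∃ h : L →ₗ[A] M, g ∘ₗ h = LinearMap.id

/-- `0 → N → M → L → 0` is pure exact: it is short exact, and it stays short exact after
tensoring with any `A`-module. -/
structure IsPureExact (f : N →ₗ[A] M) (g : M →ₗ[A] L) : Prop extends IsShortExact f g where
  tensor : ∀ (T : Type u) [AddCommGroup T] [Module A T],
    IsShortExact (f.lTensor T) (g.lTensor T)

/-- `0 → N → M → L → 0` is `S`-pure exact: it is pure exact, its base change to `A_S` is split
exact over `A_S`, and for every `s ∈ S` its base change to `A/sA` is split exact over `A/sA`. -/
structure IsSPureExact (S : Submonoid A) (f : N →ₗ[A] M) (g : M →ₗ[A] L) : Prop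
    extends IsPureExact f g where
  localization :
    IsSplitExact (f.baseChange (Localization S)) (g.baseChange (Localization S))
  quotient : ∀ s ∈ S,
    IsSplitExact (f.baseChange (A ⧸ Ideal.span {s})) (g.baseChange (A ⧸ Ideal.span {s}))

end Exactness

section Pullback

variable {A : Type u} [CommRing A]
variable {X Y U Z : Type u} [AddCommGroup X] [Module A X] [AddCommGroup Y] [Module A Y]
  [AddCommGroup U] [Module A U] [AddCommGroup Z] [Module A Z]

/-- The pullback `{(y, u) | g y = φ u}` of `g : Y → Z` and `φ : U → Z`. -/
def Pullback (g : Y →ₗ[A] Z) (φ : U →ₗ[A] Z) : Submodule A (Y × U) :=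
  LinearMap.eqLocus (g ∘ₗ LinearMap.fst A Y U) (φ ∘ₗ LinearMap.snd A Y U)

/-- The map `Pullback g φ → U` in the pulled back sequence. -/
def Pullback.toRight (g : Y →ₗ[A] Z) (φ : U →ₗ[A] Z) : Pullback g φ →ₗ[A] U :=
  LinearMap.snd A Y U ∘ₗ (Pullback g φ).subtype

/-- The map `X → Pullback g φ`, `x ↦ (f x, 0)`, in the pullback along `φ` of an exact sequence
`0 → X → Y → Z → 0` with maps `f` and `g`. -/
def Pullback.ofLeft (f : X →ₗ[A] Y) (g : Y →ₗ[A] Z) (φ : U →ₗ[A] Z)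
    (h : Function.Exact f g) : X →ₗ[A] Pullback g φ :=
  LinearMap.codRestrict (Pullback g φ) (LinearMap.inl A Y U ∘ₗ f) (fun x => by
    simp [Pullback, LinearMap.mem_eqLocus, h.apply_apply_eq_zero x])

/-- `φ : U → Z` is a phantom morphism: the pullback along `φ` of every short exact sequence
with right term `Z` is pure exact. -/
def IsPhantom (φ : U →ₗ[A] Z) : Prop :=
  ∀ (X Y : Type u) [AddCommGroup X] [Module A X] [AddCommGroup Y] [Module A Y]
    (f : X →ₗ[A] Y) (g : Y →ₗ[A] Z) (h : IsShortExact f g),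
    IsPureExact (Pullback.ofLeft f g φ h.exact) (Pullback.toRight g φ)

/-- `φ : U → Z` is an `S`-phantom morphism: the pullback along `φ` of every short exact sequence
with right term `Z` is `S`-pure exact. -/
def IsSPhantom (S : Submonoid A) (φ : U →ₗ[A] Z) : Prop :=
  ∀ (X Y : Type u) [AddCommGroup X] [Module A X] [AddCommGroup Y] [Module A Y]
    (f : X →ₗ[A] Y) (g : Y →ₗ[A] Z) (h : IsShortExact f g),
    IsSPureExact S (Pullback.ofLeft f g φ h.exact) (Pullback.toRight g φ)

end Pullback

/-- A commutative ring is perfect (in the sense of Bass) if every flat module is projective. -/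
def IsPerfect (A : Type u) [CommRing A] : Prop :=
  ∀ (F : Type u) [AddCommGroup F] [Module A F], Module.Flat A F → Module.Projective A F

/-- `R` is `S`-almost perfect: `R_S` is perfect, and `R/sR` is perfect for every `s ∈ S`. -/
structure IsAlmostPerfect (R : Type u) [CommRing R] (S : Submonoid R) : Prop where
  localization : IsPerfect (Localization S)
  quotient : ∀ s ∈ S, IsPerfect (R ⧸ Ideal.span {s})

end StrongPurity

namespace StrongPurity

/-! ### Flat modules and phantom identities. -/

section FlatQuotient

variable {R : Type u} [CommRing R]
variable {X Y F : Type u} [AddCommGroup X] [Module R X] [AddCommGroup Y] [Module R Y]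
  [AddCommGroup F] [Module R F]

/-! A short exact sequence ending in a flat module is pure, so the identity of a flat `R`-module `F`
is phantom, hence `S`-phantom: sequences ending in `F` split over `R_S` and over each `R/sR`.

A flat `R_S`-module is flat over `R`, so a free `R_S`-presentation of it splits after base change to
`R_S`, which changes nothing (`IsPerfect.localization_of_isSPhantom`).

Flat `R/sR`-modules need not be flat over `R`. Instead a sequence in `R/sR` is lifted to `R`;
splitting the presentation of its Bass module mod `s` stops the chain of partial products
(`exists_prod_dvd_of_isSplitExact`). This gives the DCC on principal ideals, which implies
perfectness (`isPerfect_of_principalDCC`, part of Bass' Theorem P). -/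

theorem isShortExact_subtype_ker {g : Y →ₗ[R] F} (hg : Function.Surjective g) :
    IsShortExact (LinearMap.ker g).subtype g where
  injective := Submodule.subtype_injective _
  exact := LinearMap.exact_subtype_ker_map g
  surjective := hg

/-- Tensoring a short exact sequence with flat right term and one with flat middle term. -/
theorem lTensor_injective_of_flat_of_flat [Module.Flat R F] {f : X →ₗ[R] Y} {g : Y →ₗ[R] F}
    (h : IsShortExact f g) {K L T : Type u} [AddCommGroup K] [Module R K] [AddCommGroup L]
    [Module R L] [Module.Flat R L] [AddCommGroup T] [Module R T] {ι : K →ₗ[R] L} {π : L →ₗ[R] T}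
    (hπ : IsShortExact ι π) : Function.Injective (f.lTensor T) := by
  -- Chase in the 3×3 diagram of `K, L, T` tensored with `X, Y, F`; flatness of `F` and of `L` gives
  -- the two injections used.
  refine (injective_iff_map_eq_zero _).2 fun α hα => ?_
  obtain ⟨β, rfl⟩ := LinearMap.rTensor_surjective X hπ.surjective α
  have h1 : π.rTensor Y (f.lTensor _ β) = 0 := by
    rw [← hα, ← LinearMap.comp_apply, ← LinearMap.comp_apply, LinearMap.rTensor_comp_lTensor,
      LinearMap.lTensor_comp_rTensor]
  obtain ⟨γ, hγ⟩ := (rTensor_exact Y hπ.exact hπ.surjective _).1 h1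
  have h2 : g.lTensor _ γ = 0 := by
    apply Module.Flat.rTensor_preserves_injective_linearMap (M := F) ι hπ.injective
    rw [map_zero, ← LinearMap.comp_apply, LinearMap.rTensor_comp_lTensor,
      ← LinearMap.lTensor_comp_rTensor, LinearMap.comp_apply, hγ]
    exact (lTensor_exact _ h.exact h.surjective).apply_apply_eq_zero β
  obtain ⟨δ, rfl⟩ := (lTensor_exact _ h.exact h.surjective _).1 h2
  have h3 : ι.rTensor X δ = β := by
    apply Module.Flat.lTensor_preserves_injective_linearMap (M := L) f h.injective
    rw [← hγ, ← LinearMap.comp_apply, ← LinearMap.comp_apply, LinearMap.rTensor_comp_lTensor,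
      LinearMap.lTensor_comp_rTensor]
  rw [← h3]
  exact (rTensor_exact X hπ.exact hπ.surjective).apply_apply_eq_zero δ

/-- A short exact sequence whose right term is flat stays exact on the left after tensoring. -/
theorem lTensor_injective_of_flat_right [Module.Flat R F] {f : X →ₗ[R] Y} {g : Y →ₗ[R] F}
    (h : IsShortExact f g) (T : Type u) [AddCommGroup T] [Module R T] :
    Function.Injective (f.lTensor T) :=
  lTensor_injective_of_flat_of_flat h
    (isShortExact_subtype_ker (Finsupp.linearCombination_id_surjective R T))

theorem IsShortExact.isPureExact_of_flat [Module.Flat R F] {f : X →ₗ[R] Y} {g : Y →ₗ[R] F}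
    (h : IsShortExact f g) : IsPureExact f g where
  toIsShortExact := h
  tensor T _ _ :=
    ⟨lTensor_injective_of_flat_right h T, lTensor_exact T h.exact h.surjective,
      LinearMap.lTensor_surjective T h.surjective⟩

theorem IsShortExact.pullback {U : Type u} [AddCommGroup U] [Module R U] {f : X →ₗ[R] Y}
    {g : Y →ₗ[R] F} (h : IsShortExact f g) (φ : U →ₗ[R] F) :
    IsShortExact (Pullback.ofLeft f g φ h.exact) (Pullback.toRight g φ) where
  injective x y hxy := h.injective (congrArg (fun p => p.1.1) hxy)
  exact := by
    rintro ⟨⟨y, u⟩, hp⟩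
    constructor
    · intro hu
      change u = 0 at hu
      subst hu
      have hy : g y = 0 := by simpa [Pullback, LinearMap.mem_eqLocus] using hp
      obtain ⟨x, rfl⟩ := (h.exact y).1 hy
      exact ⟨x, rfl⟩
    · rintro ⟨x, hx⟩
      exact (congrArg (fun p => p.1.2) hx).symm
  surjective u := by
    obtain ⟨y, hy⟩ := h.surjective (φ u)
    exact ⟨⟨(y, u), hy⟩, rfl⟩

variable (R F) in
theorem isPhantom_id_of_flat [Module.Flat R F] : IsPhantom (LinearMap.id : F →ₗ[R] F) :=
  fun _ _ _ _ _ _ _ _ h => (h.pullback LinearMap.id).isPureExact_of_flat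

end FlatQuotient

/-! ### Bass modules and stationary chains of products. -/

section BassModule

variable {R : Type u} [CommRing R] (a : ℕ → R)

/-- The endomorphism `e n ↦ e n - a n • e (n + 1)` of the free module on `ℕ`; its cokernel is the
direct limit of `R → R → ⋯`, where the `n`-th map is multiplication by `a n`. -/
noncomputable def bassMap : (ℕ →₀ R) →ₗ[R] (ℕ →₀ R) :=
  Finsupp.linearCombination R fun n => Finsupp.single n 1 - Finsupp.single (n + 1) (a n)

theorem bassMap_single_one (n : ℕ) :
    bassMap a (Finsupp.single n 1) = Finsupp.single n 1 - a n • Finsupp.single (n + 1) 1 := by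
  simp [bassMap]

theorem bassMap_apply_zero (w : ℕ →₀ R) : bassMap a w 0 = w 0 := by
  induction w using Finsupp.induction_linear with
  | zero => simp
  | add v w hv hw => simp [hv, hw]
  | single n r => simp [bassMap, Finsupp.single_apply]

theorem bassMap_apply_succ (w : ℕ →₀ R) (k : ℕ) :
    bassMap a w (k + 1) = w (k + 1) - a k * w k := by
  induction w using Finsupp.induction_linear with
  | zero => simp
  | add v w hv hw => simp [hv, hw]; ring
  | single n r =>
    by_cases h : n = k
    · subst h; simp [bassMap, mul_comm]
    · simp [bassMap, Finsupp.single_apply, h]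

theorem bassMap_injective : Function.Injective (bassMap a) := by
  refine (injective_iff_map_eq_zero _).2 fun w hw => ?_
  ext k
  induction k with
  | zero => rw [← bassMap_apply_zero a, hw]
  | succ k ih =>
    have := bassMap_apply_succ a w k
    rw [hw, ih] at this
    simpa using this.symm

/-- The flat module of Bass attached to the sequence `a`. -/
abbrev BassModule : Type u := (ℕ →₀ R) ⧸ LinearMap.range (bassMap a)

theorem isShortExact_bassMap :
    IsShortExact (bassMap a) (LinearMap.range (bassMap a)).mkQ where
  injective := bassMap_injective a
  exact := LinearMap.exact_map_mkQ_range _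
  surjective := Submodule.mkQ_surjective _

/-- The functional `e k ↦ a k * ⋯ * a (M - 1)`. -/
noncomputable def bassFunctional (M : ℕ) : (ℕ →₀ R) →ₗ[R] R :=
  Finsupp.linearCombination R fun k => ∏ i ∈ Finset.Ico k M, a i

/-- `bassFunctional a M` reads off the coordinate at stage `M` of the direct limit, so an element of
the range is seen to vanish at a late enough stage. -/
theorem eventually_bassFunctional_bassMap (w : ℕ →₀ R) :
    ∀ᶠ M in Filter.atTop, bassFunctional a M (bassMap a w) = 0 := by
  induction w using Finsupp.induction_linear with
  | zero => simp
  | add v w hv hw => filter_upwards [hv, hw] with M h1 h2; simp [h1, h2]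
  | single n r =>
    filter_upwards [Filter.eventually_ge_atTop (n + 1)] with M hM
    rw [← mul_one r, ← smul_eq_mul, ← Finsupp.smul_single, map_smul, bassMap_single_one]
    simp [bassFunctional, Finset.prod_eq_prod_Ico_succ_bot (show n < M by omega)]

theorem mkQ_single_eq_smul {k M : ℕ} (h : k ≤ M) :
    (LinearMap.range (bassMap a)).mkQ (Finsupp.single k 1) =
      (∏ i ∈ Finset.Ico k M, a i) • (LinearMap.range (bassMap a)).mkQ (Finsupp.single M 1) := by
  induction M, h using Nat.le_induction with
  | base => simp
  | succ M hM ih =>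
    rw [ih, Finset.prod_Ico_succ_top hM, mul_smul, ← map_smul _ (a M)]
    congr 1
    rw [← sub_eq_zero, ← map_sub, ← bassMap_single_one]
    exact (isShortExact_bassMap a).exact.apply_apply_eq_zero _

theorem eventually_mkQ_eq (y : ℕ →₀ R) :
    ∀ᶠ M in Filter.atTop, (LinearMap.range (bassMap a)).mkQ y =
      bassFunctional a M y • (LinearMap.range (bassMap a)).mkQ (Finsupp.single M 1) := by
  induction y using Finsupp.induction_linear with
  | zero => simp
  | add v w hv hw =>
    filter_upwards [hv, hw] with M h1 h2
    rw [map_add, h1, h2, map_add, add_smul]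
  | single n r =>
    filter_upwards [Filter.eventually_ge_atTop n] with M hM
    rw [← mul_one r, ← smul_eq_mul, ← Finsupp.smul_single, map_smul, mkQ_single_eq_smul a hM]
    simp [bassFunctional, smul_smul]

/-- Equational criterion: a relation already holds among multiples of the single generator `e M` for
large `M`. -/
instance flat_bassModule : Module.Flat R (BassModule a) := by
  refine Module.Flat.of_forall_isTrivialRelation fun {l f x} hx => ?_
  choose y hy using fun i => Submodule.mkQ_surjective (LinearMap.range (bassMap a)) (x i)
  have h0 : (LinearMap.range (bassMap a)).mkQ (∑ i, f i • y i) = 0 := by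
    simpa [hy] using hx
  obtain ⟨w, hw⟩ := ((isShortExact_bassMap a).exact _).1 h0
  obtain ⟨M, h1, h2⟩ := ((eventually_bassFunctional_bassMap a w).and
    (Filter.eventually_all.2 fun i => eventually_mkQ_eq a (y i))).exists
  refine ⟨1, fun i _ => bassFunctional a M (y i),
    fun _ => (LinearMap.range (bassMap a)).mkQ (Finsupp.single M 1), fun i => ?_, fun _ => ?_⟩
  · rw [← hy, h2 i]; simp
  · simpa [hw] using h1

variable (A : Type u) [CommRing A] [Algebra R A]

theorem exists_baseChange_lapply_eq_zero (W : A ⊗[R] (ℕ →₀ R)) :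
    ∀ᶠ j in Filter.atTop,
      (Finsupp.lapply j : (ℕ →₀ R) →ₗ[R] R).baseChange A W = 0 := by
  induction W using TensorProduct.induction_on with
  | zero => simp
  | add v w hv hw => filter_upwards [hv, hw] with M h1 h2; simp [h1, h2]
  | tmul r y =>
    filter_upwards [Filter.eventually_gt_atTop (y.support.sup id)] with j hj
    have : y j = 0 := by
      by_contra h
      exact absurd (Finset.le_sup (f := id) (Finsupp.mem_support_iff.2 h)) (not_le.2 hj)
    simp [this]

/-- If the base change to `A` of a sequence isomorphic to the one defining the Bass module splits,
then the chain of principal ideals generated by the partial products of `a` in `A` is stationary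
somewhere. -/
theorem exists_prod_dvd_of_isSplitExact {P B : Type u} [AddCommGroup P] [Module R P]
    [AddCommGroup B] [Module R B] {u : (ℕ →₀ R) →ₗ[R] P} {g : P →ₗ[R] B}
    (h : IsSplitExact (u.baseChange A) (g.baseChange A)) (x : ℕ → P)
    (hx : ∀ n, u (Finsupp.single n 1) = x n - a n • x (n + 1)) :
    ∃ j, ∏ i ∈ Finset.range (j + 1), algebraMap R A (a i) ∣
      ∏ i ∈ Finset.range j, algebraMap R A (a i) := by
  obtain ⟨σ, hσ⟩ := h.split
  have hσ' (b) : g.baseChange A (σ b) = b := LinearMap.congr_fun hσ b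
  have hgx (n : ℕ) : g.baseChange A (1 ⊗ₜ x n) =
      algebraMap R A (a n) • g.baseChange A (1 ⊗ₜ x (n + 1)) := by
    have h1 := (h.exact.apply_apply_eq_zero ((1 : A) ⊗ₜ Finsupp.single n 1))
    rw [LinearMap.baseChange_tmul, hx, TensorProduct.tmul_sub, map_sub, sub_eq_zero,
      TensorProduct.tmul_smul, LinearMap.map_smul_of_tower] at h1
    rw [h1, algebraMap_smul]
  have hW (n : ℕ) : ∃ W, u.baseChange A W = 1 ⊗ₜ x n - σ (g.baseChange A (1 ⊗ₜ x n)) :=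
    (h.exact _).1 (by rw [map_sub, hσ', sub_self])
  -- `W n` is the component of `x n` in the kernel, along the splitting `σ`.
  choose W hW using hW
  have hrec (n : ℕ) : W n - algebraMap R A (a n) • W (n + 1) = 1 ⊗ₜ Finsupp.single n 1 := by
    apply h.injective
    have h1 : u.baseChange A (1 ⊗ₜ Finsupp.single n 1) =
        1 ⊗ₜ x n - algebraMap R A (a n) • 1 ⊗ₜ x (n + 1) := by
      rw [LinearMap.baseChange_tmul, hx, TensorProduct.tmul_sub, TensorProduct.tmul_smul,
        algebraMap_smul]
    rw [map_sub, map_smul, hW, hW, hgx, map_smul, h1]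
    module
  let c (j : ℕ) : A ⊗[R] (ℕ →₀ R) →ₗ[A] A :=
    (TensorProduct.AlgebraTensorModule.rid R A A).toLinearMap ∘ₗ
      (Finsupp.lapply j : (ℕ →₀ R) →ₗ[R] R).baseChange A
  have hc (j n : ℕ) : c j (W n) - algebraMap R A (a n) * c j (W (n + 1)) =
      if n = j then 1 else 0 := by
    rw [← smul_eq_mul, ← map_smul, ← map_sub, hrec]
    simp only [c, LinearMap.comp_apply, LinearMap.baseChange_tmul, Finsupp.lapply_apply,
      Finsupp.single_apply]
    split_ifs <;> simp
  -- `W 0` has finite support, so some coordinate `j` of it vanishes. Unrolling the recursion up to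
  -- `j` gives `0 = (a 0 ⋯ a (j-1)) * (1 + a j * c j (W (j+1)))`.
  obtain ⟨j, hj⟩ := (exists_baseChange_lapply_eq_zero A (W 0)).exists
  have hprod (n : ℕ) (hn : n ≤ j) :
      c j (W 0) = (∏ i ∈ Finset.range n, algebraMap R A (a i)) * c j (W n) := by
    induction n with
    | zero => simp
    | succ n ih =>
      have := hc j n
      rw [if_neg (by omega), sub_eq_zero] at this
      rw [ih (by omega), this, Finset.prod_range_succ, mul_assoc]
  have h0 : c j (W 0) = 0 := by simp only [c, LinearMap.comp_apply, hj, map_zero]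
  have h1 := hprod j le_rfl
  have h2 := hc j j
  rw [if_pos rfl, sub_eq_iff_eq_add] at h2
  rw [h0, h2] at h1
  refine ⟨j, -c j (W (j + 1)), ?_⟩
  rw [Finset.prod_range_succ]
  linear_combination -h1

theorem exists_prod_dvd_of_isSPureExact {S : Submonoid R} {P B : Type u} [AddCommGroup P]
    [Module R P] [AddCommGroup B] [Module R B] {u : (ℕ →₀ R) →ₗ[R] P} {g : P →ₗ[R] B}
    (h : IsSPureExact S u g) (x : ℕ → P)
    (hx : ∀ n, u (Finsupp.single n 1) = x n - a n • x (n + 1)) {s : R} (hs : s ∈ S) :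
    ∃ j, ∏ i ∈ Finset.range (j + 1), algebraMap R (R ⧸ Ideal.span {s}) (a i) ∣
      ∏ i ∈ Finset.range j, algebraMap R (R ⧸ Ideal.span {s}) (a i) :=
  exists_prod_dvd_of_isSplitExact a _ (h.quotient s hs) x hx

theorem exists_prod_dvd_of_isSPhantom {S : Submonoid R}
    (h : IsSPhantom S (LinearMap.id : BassModule a →ₗ[R] BassModule a)) {s : R} (hs : s ∈ S) :
    ∃ j, ∏ i ∈ Finset.range (j + 1), algebraMap R (R ⧸ Ideal.span {s}) (a i) ∣
      ∏ i ∈ Finset.range j, algebraMap R (R ⧸ Ideal.span {s}) (a i) := by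
  have hex := isShortExact_bassMap a
  let x (n : ℕ) : Pullback (LinearMap.range (bassMap a)).mkQ LinearMap.id :=
    ⟨(Finsupp.single n 1, (LinearMap.range (bassMap a)).mkQ (Finsupp.single n 1)), rfl⟩
  refine exists_prod_dvd_of_isSPureExact a
    (h (ℕ →₀ R) (ℕ →₀ R) (bassMap a) (LinearMap.range (bassMap a)).mkQ hex) x (fun n => ?_) hs
  refine Subtype.ext (Prod.ext (bassMap_single_one a n) ?_)
  have := hex.exact.apply_apply_eq_zero (Finsupp.single n 1)
  rw [bassMap_single_one, map_sub, map_smul] at this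
  exact this.symm

end BassModule

/-! ### Perfectness of the localization. -/

section Localization

variable {R : Type u} [CommRing R] {S : Submonoid R}

theorem IsPerfect.localization_of_isSPhantom
    (h : ∀ (F : Type u) [AddCommGroup F] [Module R F] [Module.Flat R F],
      IsSPhantom S (LinearMap.id : F →ₗ[R] F)) : IsPerfect (Localization S) := by
  intro F _ _ hF
  let : Module R F := Module.compHom F (algebraMap R (Localization S))
  have : IsScalarTower R (Localization S) F := IsScalarTower.of_algebraMap_smul fun _ _ => rfl
  have : Module.Flat R (Localization S) := IsLocalization.flat _ S
  have : Module.Flat R F := Module.Flat.trans R (Localization S) F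
  let g : (F →₀ Localization S) →ₗ[Localization S] F := Finsupp.linearCombination _ id
  have hg : Function.Surjective g := Finsupp.linearCombination_id_surjective _ F
  let g' := g.restrictScalars R
  obtain ⟨σ, hσ⟩ := (h F _ _ _ _ (isShortExact_subtype_ker (g := g') hg)).localization.split
  let p : Pullback g' LinearMap.id →ₗ[R] (F →₀ Localization S) :=
    LinearMap.fst R _ _ ∘ₗ (Pullback g' LinearMap.id).subtype
  have hp (z) : g (p z) = Pullback.toRight g' LinearMap.id z := z.2
  -- The multiplication map `R_S ⊗ F → F` carries the splitting after base change back to a section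
  -- of `g`.
  have hcomp : g ∘ₗ p.liftBaseChange (Localization S) =
      (LinearMap.id : F →ₗ[R] F).liftBaseChange (Localization S) ∘ₗ
        (Pullback.toRight g' LinearMap.id).baseChange (Localization S) := by
    ext z
    simp [hp]
  let j : F →ₗ[Localization S] Localization S ⊗[R] F :=
    (TensorProduct.mk R (Localization S) F 1).extendScalarsOfIsLocalization S (Localization S)
  refine Module.Projective.of_split (M := F →₀ Localization S)
    (p.liftBaseChange (Localization S) ∘ₗ σ ∘ₗ j) g ?_
  rw [← LinearMap.comp_assoc, hcomp, LinearMap.comp_assoc, ← LinearMap.comp_assoc _ σ, hσ]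
  ext x
  simp [j]

end Localization


/-! ### The DCC on principal ideals implies perfectness. -/

section Perfect

variable {A : Type u} [CommRing A]

variable (A) in
/-- The descending chain condition on principal ideals. -/
def PrincipalDCC : Prop :=
  ∀ s : Set A, s.Nonempty → ∃ p ∈ s, ∀ q ∈ s, p ∣ q → q ∣ p

/-- The descending chain condition on principal ideals, as a minimal condition, from the
condition that no chain of partial products is strictly decreasing. -/
theorem principalDCC_of_prod_dvd (hA : ∀ a : ℕ → A, ∃ j,
    ∏ i ∈ Finset.range (j + 1), a i ∣ ∏ i ∈ Finset.range j, a i) : PrincipalDCC A := by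
  intro s hs
  by_contra! hcon
  obtain ⟨p₀, hp₀⟩ := hs
  choose next hmem hdvd hndvd using fun p : s => hcon p p.2
  let q (n : ℕ) : s := (fun p => ⟨next p, hmem p⟩)^[n] ⟨p₀, hp₀⟩
  have hq (n : ℕ) : (q (n + 1) : A) = next (q n) := by
    simp only [q, Function.iterate_succ_apply']
  choose b hb using fun n => hdvd (q n)
  have hprod (n : ℕ) : (q n : A) = p₀ * ∏ i ∈ Finset.range n, b i := by
    induction n with
    | zero => simp [q]
    | succ n ih => rw [hq, hb, ih, Finset.prod_range_succ, mul_assoc]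
  obtain ⟨j, hj⟩ := hA b
  apply hndvd (q j)
  rw [← hq, hprod, hprod]
  exact mul_dvd_mul_left _ hj


/-- Nakayama's lemma for an ideal that is T-nilpotent on the component of an element `e`. -/
theorem subsingleton_of_smul_top_eq_top (hA : PrincipalDCC A) {M : Type u} [AddCommGroup M] [Module A M] {e : A}
    (he : ∀ x : M, e • x = x) {m : Ideal A} (hm : ∀ a ∈ m, IsNilpotent (e * a))
    (h : m • (⊤ : Submodule A M) = ⊤) : Subsingleton M := by
  refine subsingleton_of_forall_eq 0 fun x₀ => ?_
  by_contra hx₀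
  -- `p` is minimal for divisibility among the scalars that do not kill `M`; it will satisfy `p = p
  -- * (a * c)` with `e * (a * c)` nilpotent.
  obtain ⟨p, ⟨x, hx⟩, hp⟩ := hA {p | ∃ x : M, p • x ≠ 0} ⟨1, x₀, by simpa using hx₀⟩
  obtain ⟨a, ha, y, hy⟩ : ∃ a ∈ m, ∃ y : M, (p * a) • y ≠ 0 := by
    by_contra! hcon
    refine hx ?_
    have hle : m • (⊤ : Submodule A M) ≤ LinearMap.ker (LinearMap.lsmul A M p) :=
      Submodule.smul_le.2 fun a ha y _ => by
        simpa [smul_smul, mul_comm] using hcon a ha y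
    rw [h] at hle
    exact hle Submodule.mem_top
  obtain ⟨c, hc⟩ := hp (p * a) ⟨y, hy⟩ (dvd_mul_right _ _)
  have hpow (n : ℕ) : p = p * (a * c) ^ n := by
    induction n with
    | zero => simp
    | succ n ih => rw [pow_succ, ← mul_assoc, ← ih, ← mul_assoc, ← hc]
  have hepow (n : ℕ) (z : M) : e ^ n • z = z := by
    induction n with
    | zero => simp
    | succ n ih => rw [pow_succ, mul_smul, he, ih]
  obtain ⟨n, hn⟩ := hm (a * c) (m.mul_mem_right c ha)
  apply hx
  rw [← hepow n x, hpow n, smul_smul, mul_assoc, ← mul_pow, mul_comm (a * c) e, hn, mul_zero,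
    zero_smul]

/-- The powers of `a` stabilize: `a ^ m = a ^ (2 * m) * c` makes `a ^ m * c` idempotent. Taking `m`
positive ensures that `a` divides it. -/
theorem exists_isIdempotentElem (hA : PrincipalDCC A) (a : A) :
    ∃ n c, IsIdempotentElem (a ^ n * c) ∧ a ^ n * (a ^ n * c) = a ^ n ∧ a ∣ a ^ n * c := by
  obtain ⟨_, ⟨n, rfl⟩, hp⟩ := hA (Set.range fun n => a ^ (n + 1)) ⟨_, 0, rfl⟩
  obtain ⟨c, hc⟩ := hp (a ^ (2 * n + 1 + 1)) ⟨_, rfl⟩ (pow_dvd_pow a (by omega))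
  dsimp only at hc
  have hc' : a ^ (n + 1) * (a ^ (n + 1) * c) = a ^ (n + 1) := by
    conv_rhs => rw [hc]
    ring
  refine ⟨n + 1, c, ?_, hc', (dvd_pow_self a n.succ_ne_zero).mul_right c⟩
  rw [IsIdempotentElem]
  linear_combination c * hc'

/-- The ideal of elements that are nilpotent on the component of `e`. -/
def nilpotentOn (e : A) : Ideal A :=
  Submodule.comap (LinearMap.mulLeft A e) (nilradical A)

theorem mem_nilpotentOn {e a : A} : a ∈ nilpotentOn e ↔ IsNilpotent (e * a) := by
  simp [nilpotentOn, mem_nilradical]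

/-- The idempotent built from `a` either kills `e`, and then `e * a` is nilpotent, or fixes `e`, and
then `a` divides `e`. -/
theorem dvd_of_notMem_nilpotentOn (hA : PrincipalDCC A) {e : A}
    (hprim : ∀ f, IsIdempotentElem f → e * f = 0 ∨ e * f = e) {a : A}
    (ha : a ∉ nilpotentOn e) : a ∣ e := by
  obtain ⟨n, c, hf, hac, hdvd⟩ := exists_isIdempotentElem hA a
  rcases hprim _ hf with h | h
  · refine absurd (mem_nilpotentOn.2 ⟨n + 1, ?_⟩) ha
    rw [mul_pow, pow_succ a, ← hac, pow_succ]
    linear_combination (e ^ n * a ^ n * a) * h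
  · exact h ▸ hdvd.mul_left e

theorem isMaximal_nilpotentOn (hA : PrincipalDCC A) {e : A} (he : IsIdempotentElem e) (he0 : e ≠ 0)
    (hprim : ∀ f, IsIdempotentElem f → e * f = 0 ∨ e * f = e) : (nilpotentOn e).IsMaximal := by
  refine Ideal.isMaximal_iff.2 ⟨fun h => ?_, fun J x hJ hx hxJ => ?_⟩
  · obtain ⟨n, hn⟩ := mem_nilpotentOn.1 h
    have : e ^ (n + 1) = 0 := by rw [pow_succ, ← mul_one e, hn]; simp
    exact he0 (by rwa [he.pow_succ_eq] at this)
  · obtain ⟨c, hc⟩ := dvd_of_notMem_nilpotentOn hA hprim hx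
    have h1 : 1 - e ∈ nilpotentOn e :=
      mem_nilpotentOn.2 (by rw [mul_sub, mul_one, he.eq, sub_self]; exact IsNilpotent.zero)
    rw [← sub_add_cancel 1 e]
    exact J.add_mem (hJ h1) (hc ▸ J.mul_mem_right c hxJ)

/-- A relation between the elements of a flat module with coefficients in `m` comes from
relations multiplied by elements of `m`. -/
theorem mem_smul_ker_of_flat {F ι : Type*} [AddCommGroup F] [Module A F] [Module.Flat A F]
    {g : (ι →₀ A) →ₗ[A] F} (hg : Function.Surjective g) {m : Ideal A} {k : ι →₀ A}
    (hk : g k = 0) (hkm : ∀ i, k i ∈ m) : k ∈ m • LinearMap.ker g := by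
  classical
  have hsum : k = ∑ i : k.support, k i • Finsupp.single (i : ι) (1 : A) := by
    conv_lhs => rw [← Finsupp.sum_single k]
    rw [Finsupp.sum, ← Finset.sum_coe_sort]
    simp
  have hrel : ∑ i : k.support, k i • g (Finsupp.single (i : ι) 1) = 0 := by
    rw [hsum, map_sum] at hk
    simpa only [map_smul] using hk
  obtain ⟨κ, a, y, hay, hka⟩ := Module.Flat.isTrivialRelation_of_sum_smul_eq_zero hrel
  choose p hp using fun j => hg (y j)
  have hsum' : k = ∑ i : k.support, k i • (Finsupp.single (i : ι) (1 : A) - ∑ j, a i j • p j) := by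
    have h0 : ∑ i : k.support, k i • ∑ j, a i j • p j = 0 := by
      simp_rw [Finset.smul_sum, smul_smul]
      rw [Finset.sum_comm]
      simp_rw [← Finset.sum_smul, hka, zero_smul, Finset.sum_const_zero]
    simp_rw [smul_sub]
    rw [Finset.sum_sub_distrib, h0, sub_zero, ← hsum]
  rw [hsum']
  refine Submodule.sum_mem _ fun i _ => Submodule.smul_mem_smul (hkm i) ?_
  rw [LinearMap.mem_ker, map_sub, map_sum, sub_eq_zero]
  exact (hay i).trans (Finset.sum_congr rfl fun j _ => by rw [map_smul, hp])

/-- Lifting a basis of `F / m F`. -/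
theorem exists_lift_basis {F : Type u} [AddCommGroup F] [Module A F] {m : Ideal A}
    (hm : m.IsMaximal) : ∃ (ι : Type u) (g : (ι →₀ A) →ₗ[A] F),
      LinearMap.range g ⊔ m • ⊤ = ⊤ ∧ ∀ k, g k ∈ m • (⊤ : Submodule A F) → ∀ i, k i ∈ m := by
  let := Ideal.Quotient.field m
  let Q := F ⧸ m • (⊤ : Submodule A F)
  let b := Module.Free.chooseBasis (A ⧸ m) Q
  choose v hv using fun i => Submodule.mkQ_surjective (m • (⊤ : Submodule A F)) (b i)
  let g := Finsupp.linearCombination A v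
  have hg (k) (i) : b.repr ((m • (⊤ : Submodule A F)).mkQ (g k)) i = Ideal.Quotient.mk m (k i) := by
    classical
    induction k using Finsupp.induction_linear with
    | zero => simp
    | add k l hk hl => simp only [map_add, Finsupp.add_apply, hk, hl]
    | single j r =>
      have : (m • (⊤ : Submodule A F)).mkQ (r • v j) = Ideal.Quotient.mk m r • b j := by
        rw [map_smul, hv]; rfl
      simp only [g, Finsupp.linearCombination_single, this, map_smul, b.repr_self]
      by_cases h : j = i <;> simp [h]
  refine ⟨_, g, ?_, fun k hk i => ?_⟩
  · refine eq_top_iff.2 fun x _ => ?_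
    obtain ⟨k, hk⟩ := Finsupp.mapRange_surjective (Ideal.Quotient.mk m) (map_zero _)
      Ideal.Quotient.mk_surjective (b.repr ((m • (⊤ : Submodule A F)).mkQ x))
    have hk : (m • (⊤ : Submodule A F)).mkQ (g k) = (m • (⊤ : Submodule A F)).mkQ x := by
      apply b.repr.injective
      ext i
      rw [hg, ← hk, Finsupp.mapRange_apply]
    rw [← add_sub_cancel (g k) x]
    refine Submodule.add_mem_sup ⟨k, rfl⟩ ?_
    rw [← Submodule.Quotient.mk_eq_zero, Submodule.Quotient.mk_sub, sub_eq_zero]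
    exact hk.symm
  · rw [← Ideal.Quotient.eq_zero_iff_mem, ← hg]
    have : (m • (⊤ : Submodule A F)).mkQ (g k) = 0 := (Submodule.Quotient.mk_eq_zero _).2 hk
    rw [this]; simp

/-- `F` is a retract of a free module, via a lifted basis of `F / m F`. Nakayama is used twice: on
the cokernel of `g`, and on `e • ker g`, where flatness gives `ker g = m • ker g`. -/
theorem projective_of_primitive (hA : PrincipalDCC A) {e : A} (he : IsIdempotentElem e)
    (hprim : ∀ f, IsIdempotentElem f → e * f = 0 ∨ e * f = e)
    {F : Type u} [AddCommGroup F] [Module A F] [Module.Flat A F] (heF : ∀ x : F, e • x = x) :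
    Module.Projective A F := by
  by_cases he0 : e = 0
  · have : Subsingleton F := subsingleton_of_forall_eq 0 fun x => by rw [← heF x, he0, zero_smul]
    infer_instance
  obtain ⟨ι, g, hsup, hker⟩ := exists_lift_basis (F := F) (isMaximal_nilpotentOn hA he he0 hprim)
  have hnil : ∀ a ∈ nilpotentOn e, IsNilpotent (e * a) := fun a => mem_nilpotentOn.1
  have hsurj : Function.Surjective g := by
    have : Subsingleton (F ⧸ LinearMap.range g) := by
      refine subsingleton_of_smul_top_eq_top hA (e := e) (fun x => ?_) hnil ?_
      · obtain ⟨x, rfl⟩ := Submodule.mkQ_surjective _ x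
        rw [← map_smul, heF]
      · have := congrArg (Submodule.map (LinearMap.range g).mkQ) hsup
        rwa [Submodule.map_sup, Submodule.map_smul'', Submodule.map_top, Submodule.range_mkQ,
          Submodule.mkQ_map_self, bot_sup_eq] at this
    rw [← LinearMap.range_eq_top]
    exact Submodule.Quotient.subsingleton_iff.1 this
  have hK (k : ι →₀ A) (hk : g k = 0) : e • k = 0 := by
    let N : Submodule A (ι →₀ A) := (LinearMap.ker g).map (LinearMap.lsmul A _ e)
    have hN : Subsingleton N := by
      refine subsingleton_of_smul_top_eq_top hA (e := e) ?_ hnil ?_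
      · rintro ⟨_, x, -, rfl⟩
        refine Subtype.ext ?_
        change e • e • x = e • x
        rw [smul_smul, he.eq]
      · apply Submodule.map_injective_of_injective N.subtype_injective
        rw [Submodule.map_smul'', Submodule.map_top, Submodule.range_subtype]
        simp only [N]
        rw [← Submodule.map_smul'']
        congr 1
        refine le_antisymm Submodule.smul_le_right fun k hk => ?_
        refine mem_smul_ker_of_flat hsurj hk (hker k ?_)
        rw [LinearMap.mem_ker.1 hk]
        exact zero_mem _
    exact congrArg Subtype.val (Subsingleton.elim (⟨e • k, k, hk, rfl⟩ : N) 0)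
  let σ : F →ₗ[A] (ι →₀ A) :=
    (LinearMap.ker g).liftQ (LinearMap.lsmul A _ e) (fun k hk => hK k hk) ∘ₗ
      (g.quotKerEquivOfSurjective hsurj).symm.toLinearMap
  refine Module.Projective.of_split σ g (LinearMap.ext fun x => ?_)
  obtain ⟨k, rfl⟩ := hsurj x
  have : (g.quotKerEquivOfSurjective hsurj).symm (g k) = Submodule.Quotient.mk k := by
    rw [LinearEquiv.symm_apply_eq]; rfl
  simp only [σ, LinearMap.comp_apply, LinearEquiv.coe_coe, this, LinearMap.id_apply]
  change g (e • k) = g k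
  rw [map_smul, heF]

/-- Take an idempotent `e` minimal among those acting as the identity on a counterexample `F`. If
`f` splits `e` properly, `F` is the sum of `f F` and `(1 - f) F`, both projective by minimality;
otherwise `e` is primitive. -/
theorem isPerfect_of_principalDCC (hA : PrincipalDCC A) : IsPerfect A := by
  let s : Set A := {e | IsIdempotentElem e ∧ ∃ (F : Type u) (_ : AddCommGroup F) (_ : Module A F),
    Module.Flat A F ∧ (∀ x : F, e • x = x) ∧ ¬ Module.Projective A F}
  suffices hs : ¬ s.Nonempty by
    intro F _ _ hF
    by_contra hproj
    exact hs ⟨1, IsIdempotentElem.one, F, _, _, hF, one_smul A, hproj⟩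
  intro hs
  obtain ⟨e, ⟨he, F, _, _, hF, heF, hproj⟩, hmin⟩ := hA s hs
  have hcomp (f : A) (hf : IsIdempotentElem f) (hne : e * f ≠ e) :
      Module.Projective A (LinearMap.range (LinearMap.lsmul A F f)) := by
    have hfx (x : LinearMap.range (LinearMap.lsmul A F f)) : f • x = x := by
      obtain ⟨_, x, rfl⟩ := x
      refine Subtype.ext ?_
      change f • f • x = f • x
      rw [smul_smul, hf.eq]
    by_contra hnp
    have hflat : Module.Flat A (LinearMap.range (LinearMap.lsmul A F f)) :=
      Module.Flat.of_retract (LinearMap.range (LinearMap.lsmul A F f)).subtype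
        (LinearMap.lsmul A F f).rangeRestrict (LinearMap.ext hfx)
    have := hmin (e * f) ⟨he.mul hf, _, _, _, hflat, fun x => ?_, hnp⟩ (dvd_mul_right _ _)
    · obtain ⟨c, hc⟩ := this
      refine hne ?_
      rw [hc]
      linear_combination (e * c) * hf.eq
    · rw [mul_smul, hfx]
      exact Subtype.ext (heF x)
  by_cases hprim : ∀ f, IsIdempotentElem f → e * f = 0 ∨ e * f = e
  · exact hproj (projective_of_primitive hA he hprim heF)
  · push Not at hprim
    obtain ⟨f, hf, h0, h1⟩ := hprim
    have := hcomp f hf h1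
    have := hcomp (1 - f) hf.one_sub (fun h => h0 (by linear_combination -h))
    refine hproj (Module.Projective.of_split
      ((LinearMap.lsmul A F f).rangeRestrict.prod (LinearMap.lsmul A F (1 - f)).rangeRestrict)
      ((LinearMap.range (LinearMap.lsmul A F f)).subtype.coprod
        (LinearMap.range (LinearMap.lsmul A F (1 - f))).subtype) (LinearMap.ext fun x => ?_))
    change f • x + (1 - f) • x = x
    module

end Perfect

end StrongPurity

theorem mainTheorem5 (R : Type u) [CommRing R] (S : Submonoid R)
    (hphantom : ∀ (U Z : Type u) [AddCommGroup U] [Module R U] [AddCommGroup Z] [Module R Z]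
      (φ : U →ₗ[R] Z), StrongPurity.IsPhantom φ → StrongPurity.IsSPhantom S φ) :
    StrongPurity.IsAlmostPerfect R S := by
  have h (F : Type u) [AddCommGroup F] [Module R F] [Module.Flat R F] :
      StrongPurity.IsSPhantom S (LinearMap.id : F →ₗ[R] F) :=
    hphantom F F _ (StrongPurity.isPhantom_id_of_flat R F)
  refine ⟨StrongPurity.IsPerfect.localization_of_isSPhantom h, fun s hs => ?_⟩
  refine StrongPurity.isPerfect_of_principalDCC
    (StrongPurity.principalDCC_of_prod_dvd fun a => ?_)
  choose b hb using fun i => Ideal.Quotient.mk_surjective (a i)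
  obtain ⟨j, hj⟩ := StrongPurity.exists_prod_dvd_of_isSPhantom b (h (StrongPurity.BassModule b)) hs
  refine ⟨j, ?_⟩
  simpa only [Ideal.Quotient.algebraMap_eq, hb] using hj
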